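/- Let $1\le K<N$ and consider the service-placement problem with $N$ services, at most $K$ of which can be placed at the edge at any time. Service $i$ has arrival rate $\lambda_i>0$ and delivery rate $\mu_i>0$. The number $S_i(t)\in\{0,1,2,\dots\}$ of its outstanding requests is a controlled continuous-time jump process: with action $a\in\{0,1\}$ in force ($1$ = active, i.e. placed at the edge; $0$ = passive), it moves from $s$ to $s+1$ at rate $\lambda_i$ and from $s$ to $s-1$ at rate $\mu_i s a$. The action is chosen at time $0$ and at every jump of $S_i$, as a (measurable) function of all states and jump times observed so far, and is held until the next jump. For a subsidy $W\in\mathbb R$, the single-service MDP of service $i$ is to minimise over all such policies $\pi$ the average cost $$\bar C_{\pi,i}(W)=\limsup_{T\to\infty}\frac1T\,\mathbb E_\pi\left[\int_0^T\left(\frac{S_i(t)}{\lambda_i}-W\,(1-A_i(t))\right)dt\right]\in(-\infty,+\infty].$$ A stationary policy $\varphi:\{0,1,2,\dots\}\to\{0,1\}$ (use action $\varphi(s)$ in state $s$) is called optimal for $W$ if, from every initial state, its average cost is at most that of every policy. Let $D_i(W)$ be the set of states $s$ in which the passive action is optimal, i.e. $\varphi(s)=0$ for some stationary policy $\varphi$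 that is optimal for $W$. The single-service MDP is indexable if $D_i(W')\subseteq D_i(W)$ whenever $W'<W$, and the $N$-service problem is indexable if each of its $N$ single-service MDPs is indexable. Then, for every $i$ and every $W\in\mathbb R$, the single-service MDP of service $i$ with subsidy $W$ has an optimal stationary policy, and each single-service MDP, hence the $N$-service service-placement MDP, is indexable. -/

import Mathlib

open MeasureTheory ProbabilityTheory Filter
open scoped ENNReal

noncomputable section

namespace EdgeService

/-- Parameters of one service: requests arrive at rate `arr` (`λ` in the usual notation), and each
outstanding request is served at rate `srv` (`μ`) while the service is placed at the edge. -/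
structure Service where
  arr : ℝ
  srv : ℝ
  arr_pos : 0 < arr
  srv_pos : 0 < srv

namespace Service

variable (B : Service)

/-- Action `true` is "active" (the service is placed at the edge), `false` is "passive".
Rate of `s → s + 1`. -/
def birthRate (_s : ℕ) (_a : Bool) : ℝ := B.arr

/-- Rate of `s → s - 1` (the `M/M/k` rate `μ s a`). -/
def deathRate (s : ℕ) (a : Bool) : ℝ := if a then B.srv * s else 0

/-- Total rate at which the state is left. -/
def totalRate (s : ℕ) (a : Bool) : ℝ := B.birthRate s a + B.deathRate s a

/-- Instantaneous latency cost `C(s, a) = s / λ`. -/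
def cost (s : ℕ) (_a : Bool) : ℝ := s / B.arr

lemma deathRate_nonneg (s : ℕ) (a : Bool) : 0 ≤ B.deathRate s a := by
  unfold deathRate
  split_ifs
  · exact mul_nonneg B.srv_pos.le (Nat.cast_nonneg s)
  · exact le_rfl

lemma birthRate_pos (s : ℕ) (a : Bool) : 0 < B.birthRate s a := B.arr_pos

lemma totalRate_pos (s : ℕ) (a : Bool) : 0 < B.totalRate s a :=
  add_pos_of_pos_of_nonneg (B.birthRate_pos s a) (B.deathRate_nonneg s a)

/-- Law of the state after the next event, when action `a` is in force in state `s`. -/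
def jumpLaw (s : ℕ) (a : Bool) : Measure ℕ :=
  ENNReal.ofReal (B.birthRate s a / B.totalRate s a) • Measure.dirac (s + 1) +
    ENNReal.ofReal (B.deathRate s a / B.totalRate s a) • Measure.dirac (s - 1)

instance (s : ℕ) (a : Bool) : IsProbabilityMeasure (B.jumpLaw s a) := by
  constructor
  have h : B.birthRate s a / B.totalRate s a + B.deathRate s a / B.totalRate s a = 1 := by
    rw [← add_div]
    exact div_self (B.totalRate_pos s a).ne'
  simp only [jumpLaw, Measure.coe_add, Measure.coe_smul, Pi.add_apply, Pi.smul_apply, measure_univ,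
    smul_eq_mul, mul_one]
  rw [← ENNReal.ofReal_add (div_nonneg (B.birthRate_pos s a).le (B.totalRate_pos s a).le)
    (div_nonneg (B.deathRate_nonneg s a) (B.totalRate_pos s a).le), h, ENNReal.ofReal_one]

/-- Law of (next state, time until the next event): the sojourn time is exponential with the total
rate and independent of the next state. -/
def eventLaw (s : ℕ) (a : Bool) : Measure (ℕ × ℝ) :=
  (B.jumpLaw s a).prod (expMeasure (B.totalRate s a))

instance (s : ℕ) (a : Bool) : IsProbabilityMeasure (B.eventLaw s a) := by
  have := isProbabilityMeasure_expMeasure (B.totalRate_pos s a)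
  unfold eventLaw
  infer_instance

end Service

/-- What has been observed up to the `n`-th event: entry `k` is the pair (state right after the
`k`-th event, time elapsed between events `k - 1` and `k`). Entry `0` holds the initial state and a
dummy time. -/
abbrev History (n : ℕ) : Type := (k : Finset.Iic n) → ℕ × ℝ

/-- The state right after the `n`-th event. -/
def History.current {n : ℕ} (h : History n) : ℕ := (h ⟨n, Finset.mem_Iic.2 le_rfl⟩).1

lemma History.measurable_current {n : ℕ} : Measurable (History.current (n := n)) :=
  measurable_fst.comp (measurable_pi_apply _)

/-- A history-dependent policy: at every event (and at time `0`) it selects, from the whole past,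
the action that is held until the next event. Past actions are functions of past
states and times, so they need not be recorded in the history. -/
structure Policy where
  act : (n : ℕ) → History n → Bool
  measurable_act : ∀ n, Measurable (act n)

/-- The stationary policy that takes action `φ s` whenever the state is `s`. -/
def Policy.stationary (φ : ℕ → Bool) : Policy where
  act _ h := φ h.current
  measurable_act _ := (measurable_of_countable φ).comp History.measurable_current

namespace Service

variable (B : Service)

/-- Conditional law of the `(n+1)`-st event given the history, under the policy `π`. -/
def step (π : Policy) (n : ℕ) : Kernel (History n) (ℕ × ℝ) :=
  (Kernel.ofFunOfCountable fun p : ℕ × Bool => B.eventLaw p.1 p.2).comap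
    (fun h => (h.current, π.act n h))
    (History.measurable_current.prodMk (π.measurable_act n))

instance (π : Policy) (n : ℕ) : IsMarkovKernel (B.step π n) :=
  ⟨fun h => inferInstanceAs
    (IsProbabilityMeasure (B.eventLaw h.current (π.act n h)))⟩

/-- Law of the whole sequence of events under the policy `π`, started in state `s₀`. -/
def pathLaw (π : Policy) (s₀ : ℕ) : Measure (ℕ → ℕ × ℝ) :=
  Kernel.traj (X := fun _ => ℕ × ℝ) (B.step π) 0 (fun _ => (s₀, 0))

end Service

/-- Time of the `n`-th event (`eventTime ω 0 = 0`). -/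
def eventTime (ω : ℕ → ℕ × ℝ) (n : ℕ) : ℝ := ∑ k ∈ Finset.range n, (ω (k + 1)).2

/-- Number of events during `(0, t]`. -/
def eventCount (ω : ℕ → ℕ × ℝ) (t : ℝ) : ℕ := {k : ℕ | eventTime ω (k + 1) ≤ t}.ncard

/-- The state `S(t)`. -/
def stateAt (ω : ℕ → ℕ × ℝ) (t : ℝ) : ℕ := (ω (eventCount ω t)).1

/-- The action `A(t)`. -/
def actionAt (π : Policy) (ω : ℕ → ℕ × ℝ) (t : ℝ) : Bool :=
  π.act (eventCount ω t) fun k => ω k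

namespace Service

variable (B : Service)

/-- `E_π ∫₀ᵀ C(S(t), A(t)) dt`, for the initial state `s₀`. -/
def expectedCost (π : Policy) (s₀ : ℕ) (T : ℝ) : ℝ≥0∞ :=
  ∫⁻ ω, (∫⁻ t in Set.Ioc 0 T, ENNReal.ofReal (B.cost (stateAt ω t) (actionAt π ω t)) ∂volume)
    ∂(B.pathLaw π s₀)

/-- `E_π ∫₀ᵀ (1 - A(t)) dt`, which is at most `T`. -/
def expectedPassiveTime (π : Policy) (s₀ : ℕ) (T : ℝ) : ℝ≥0∞ :=
  ∫⁻ ω, (∫⁻ t in Set.Ioc 0 T, (if actionAt π ω t then 0 else 1) ∂volume) ∂(B.pathLaw π s₀)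

/-- Long-run average cost with subsidy `W` for passivity:
`limsup_{T → ∞} T⁻¹ E_π ∫₀ᵀ (C(S(t), A(t)) - W (1 - A(t))) dt`, possibly `+∞`. -/
def avgCost (W : ℝ) (π : Policy) (s₀ : ℕ) : EReal :=
  limsup (fun T : ℝ =>
    ((B.expectedCost π s₀ T : EReal) - ((W * (B.expectedPassiveTime π s₀ T).toReal : ℝ) : EReal))
      / (T : EReal)) atTop

/-- The stationary policy `φ` is optimal for subsidy `W`: for every initial state no
history-dependent policy has smaller average cost. -/
def IsOptimal (W : ℝ) (φ : ℕ → Bool) : Prop :=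
  ∀ (s₀ : ℕ) (π : Policy), B.avgCost W (Policy.stationary φ) s₀ ≤ B.avgCost W π s₀

/-- `D(W)`: the states in which the passive action is optimal, that is, is taken by an optimal
stationary policy. -/
def passiveSet (W : ℝ) : Set ℕ := {s | ∃ φ : ℕ → Bool, B.IsOptimal W φ ∧ φ s = false}

/-- Indexability of the single-service MDP: `D(W)` increases with the subsidy `W`. -/
def Indexable : Prop := ∀ W W' : ℝ, W' < W → B.passiveSet W' ⊆ B.passiveSet W

end Service

/-- The service-placement problem: `N` services, of which at most `K` can be at the edge at any
time; service `i` evolves with the rates and the cost of `service i`. -/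
structure ServicePlacement (N K : ℕ) where
  service : Fin N → Service
  capacity_pos : 0 < K
  capacity_lt : K < N

/-- The service-placement problem is indexable if each of its `N` single-service MDPs is. -/
def ServicePlacement.Indexable {N K : ℕ} (M : ServicePlacement N K) : Prop :=
  ∀ i, (M.service i).Indexable

end EdgeService

end

/-!
A stationary policy `φ` matters only through its threshold `m`: if `m - 1` is its largest passive
state, the process is eventually confined to `{m - 1, m, …}`, where it is active except in its
lowest state. The average cost of such a policy is explicit,
`g m = 1 / μ + ((m - 1) / λ - W) * p m` (`thresholdCost`), where `p m` is the fraction of passive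
time; `p 0 = 0` and `p (n + 1) = (∑ k, ρ ^ k n! / (n + k)!)⁻¹` with `ρ = λ / μ`. It tends to
infinity with `m`, so it has a minimum. With infinitely many passive states the process drifts to
infinity, and so does its cost.

*Verification.* Let `L` be the generator of the controlled process. A nonnegative potential `h` with
`C - W (1 - A) + L h ≤ g` along a policy bounds the average cost of that policy by `g` from above
(`avgCost_le`), and a potential that is bounded above with the reverse inequality bounds it by `g`
from below (`le_avgCost`). Both come from one inequality between nonnegative quantities
(`tsum_sojournCost_le`): with `σ` the next sojourn time, of rate `q`, and `r` the time left before
the horizon, `P(σ ≤ r) = q E[min r σ]` turns the drift condition into an inequality for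
one event, and this is summed over all events. The potential `h s = s` shows in the same way that
only finitely many events happen in finite time.

*Upper bound.* For the threshold `m`, Poisson's equation with constant `g m` has an explicit
solution whose increments tend to `1 / (λ μ) > 0`, so it is bounded below
(`avgCost_thresholdPolicy_le`).

*Lower bound.* For `g < min g m`, solve the optimality equation with constant `g` upwards from state
`0`. The solution also solves Poisson's equation with constant `g` for the maximizing stationary
policy. If that policy has a threshold, the increments lag behind those of the true solution by an
amount that grows at least linearly; otherwise they are reset at every passive state, to nonpositive
values in large ones. Either way they are nonpositive in arbitrarily large states
(`exists_slope_nonpos`). Replacing them by `0` past such a state keeps the drift inequality and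
makes the potential bounded (`le_avgCost_of_slope`). Hence no policy beats `min g m`. The same
argument for a fixed stationary policy shows that an optimal one has a threshold, and that this
threshold minimizes `g` (`IsOptimal.exists_isThreshold`).

*Indexability.* As `W` multiplies `-p m` in `g m` and `p` is strictly increasing, minimizing
thresholds increase with `W` (`threshold_le_of_lt`). A state that is passive for a policy optimal
for `W'` lies below its threshold, hence below every minimizing threshold for `W > W'`.
-/

noncomputable section

namespace EdgeService

/-! ### Sojourn times and the law of the next event -/

/-- Truncating an exponential time `σ` of rate `q` at level `r`: `P(σ ≤ r) = q E[min r σ]`, where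
negative values of the minimum count as `0`. -/
lemma expMeasure_Iic {q : ℝ} (hq : 0 < q) (r : ℝ) :
    expMeasure q (Set.Iic r)
      = ENNReal.ofReal q * ∫⁻ σ, ENNReal.ofReal (min r σ) ∂(expMeasure q) := by
  have := isProbabilityMeasure_expMeasure hq
  have hIic : ∀ t, expMeasure q (Set.Iic t)
      = ENNReal.ofReal (if 0 ≤ t then 1 - Real.exp (-(q * t)) else 0) := by
    intro t
    rw [← cdf_expMeasure_eq hq, cdf_eq_real, ofReal_measureReal]
  have hIoi : ∀ t, 0 ≤ t → expMeasure q (Set.Ioi t) = ENNReal.ofReal (Real.exp (-(q * t))) := by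
    intro t ht
    rw [← Set.compl_Iic, prob_compl_eq_one_sub measurableSet_Iic, hIic, if_pos ht,
      ← ENNReal.ofReal_one, ← ENNReal.ofReal_sub _ (by
        rw [sub_nonneg, Real.exp_le_one_iff]; nlinarith)]
    congr 1
    ring
  rcases le_or_gt 0 r with hr | hr
  swap
  · rw [hIic, if_neg (not_le.2 hr), lintegral_congr
      (fun σ => ENNReal.ofReal_of_nonpos ((min_le_left r σ).trans hr.le))]
    simp
  have hmin : ∫⁻ σ, ENNReal.ofReal (min r σ) ∂(expMeasure q)
      = ∫⁻ σ, ENNReal.ofReal (min r (max σ 0)) ∂(expMeasure q) := by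
    refine lintegral_congr fun σ => ?_
    rcases le_total σ 0 with h | h
    · rw [max_eq_right h, min_eq_right hr, min_eq_right (h.trans hr),
        ENNReal.ofReal_of_nonpos h, ENNReal.ofReal_zero]
    · rw [max_eq_left h]
  rw [hmin, lintegral_eq_lintegral_meas_lt _
    (Eventually.of_forall fun σ => le_min hr (le_max_right σ 0)) (by fun_prop)]
  have hset : ∀ t ∈ Set.Ioi (0 : ℝ), expMeasure q {σ | t < min r (max σ 0)}
      = (Set.Iio r).indicator (fun t => ENNReal.ofReal (Real.exp (-(q * t)))) t := by
    intro t ht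
    by_cases htr : t < r
    · rw [Set.indicator_of_mem (Set.mem_Iio.2 htr), ← hIoi t ht.le]
      congr 1
      ext σ
      simp [htr, not_lt.2 (le_of_lt (Set.mem_Ioi.1 ht))]
    · rw [Set.indicator_of_notMem (by simpa using htr)]
      simp [htr]
  rw [setLIntegral_congr_fun measurableSet_Ioi hset, lintegral_indicator measurableSet_Iio,
    Measure.restrict_restrict measurableSet_Iio, ← lintegral_const_mul _ (by fun_prop), hIic,
    ← lintegral_exponentialPDF_eq_antiDeriv hq,
    ← lintegral_add_compl (μ := volume.restrict (Set.Iic r)) _ (measurableSet_Ici (a := (0 : ℝ)))]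
  rw [Measure.restrict_restrict measurableSet_Ici,
    Measure.restrict_restrict measurableSet_Ici.compl,
    Set.Ici_inter_Iic, Set.inter_comm (Set.Iio r), Set.Ioi_inter_Iio,
    restrict_Ioo_eq_restrict_Icc]
  have hneg : ∫⁻ y in (Set.Ici (0 : ℝ))ᶜ ∩ Set.Iic r, exponentialPDF q y = 0 := by
    rw [setLIntegral_congr_fun (measurableSet_Ici.compl.inter measurableSet_Iic)
      (g := fun _ => 0)
      (fun y hy => exponentialPDF_of_neg (by simpa using hy.1)), lintegral_zero]
  rw [hneg, add_zero]
  refine setLIntegral_congr_fun measurableSet_Icc fun y hy => ?_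
  rw [exponentialPDF_of_nonneg hy.1, ENNReal.ofReal_mul hq.le]

lemma expMeasure_Iic_zero {q : ℝ} (hq : 0 < q) : expMeasure q (Set.Iic 0) = 0 := by
  rw [expMeasure_Iic hq, lintegral_congr
    (fun σ => ENNReal.ofReal_of_nonpos (min_le_left 0 σ))]
  simp

namespace Service

variable (B : Service)

lemma lintegral_eventLaw_min (s : ℕ) (a : Bool) (r : ℝ) :
    ∫⁻ e, ENNReal.ofReal (min r e.2) ∂(B.eventLaw s a)
      = ∫⁻ σ, ENNReal.ofReal (min r σ) ∂(expMeasure (B.totalRate s a)) := by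
  have := isProbabilityMeasure_expMeasure (B.totalRate_pos s a)
  rw [eventLaw, lintegral_prod _ (by fun_prop)]
  simp

/-- Value of a potential `h` after the next event, provided that event falls within the
remaining time `r`: by independence and `expMeasure_Iic` it is a mean sojourn time multiplied by
jump rates. -/
lemma lintegral_eventLaw_potential (s : ℕ) (a : Bool) (r : ℝ) (h : ℕ → ℝ≥0∞) :
    ∫⁻ e, (if e.2 ≤ r then h e.1 else 0) ∂(B.eventLaw s a)
      = (∫⁻ e, ENNReal.ofReal (min r e.2) ∂(B.eventLaw s a)) *
        (ENNReal.ofReal (B.birthRate s a) * h (s + 1)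
          + ENNReal.ofReal (B.deathRate s a) * h (s - 1)) := by
  have hq := B.totalRate_pos s a
  have := isProbabilityMeasure_expMeasure hq
  have hprod : ∀ e : ℕ × ℝ, (if e.2 ≤ r then h e.1 else 0)
      = h e.1 * (Set.Iic r).indicator 1 e.2 := by
    intro e
    by_cases he : e.2 ≤ r <;> simp [he]
  simp_rw [lintegral_eventLaw_min, hprod]
  rw [eventLaw, lintegral_prod_mul (measurable_of_countable h).aemeasurable
      ((measurable_one.indicator measurableSet_Iic).aemeasurable),
    lintegral_indicator_one measurableSet_Iic, expMeasure_Iic hq, jumpLaw, lintegral_add_measure,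
    lintegral_smul_measure, lintegral_smul_measure, lintegral_dirac, lintegral_dirac,
    ENNReal.ofReal_div_of_pos hq, ENNReal.ofReal_div_of_pos hq]
  set m := ∫⁻ σ, ENNReal.ofReal (min r σ) ∂(expMeasure (B.totalRate s a))
  set q := ENNReal.ofReal (B.totalRate s a)
  have hq0 : q ≠ 0 := by simpa [q] using hq
  have hqt : q ≠ ⊤ := ENNReal.ofReal_ne_top
  simp only [smul_eq_mul, div_eq_mul_inv]
  calc _ = (q * q⁻¹) * (m * (ENNReal.ofReal (B.birthRate s a) * h (s + 1)
          + ENNReal.ofReal (B.deathRate s a) * h (s - 1))) := by ring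
    _ = _ := by rw [ENNReal.mul_inv_cancel hq0 hqt, one_mul]

/-- Integrals of functions of the first `n` events and the next one are computed by integrating
out the next event first. -/
lemma lintegral_pathLaw_succ (π : Policy) (s₀ n : ℕ) {G : History n → ℕ × ℝ → ℝ≥0∞}
    (hG : Measurable (Function.uncurry G)) :
    ∫⁻ ω, G (fun k => ω k) (ω (n + 1)) ∂(B.pathLaw π s₀)
      = ∫⁻ ω, ∫⁻ e, G (fun k => ω k) e ∂(B.eventLaw (ω n).1 (π.act n fun k => ω k))
          ∂(B.pathLaw π s₀) := by
  have hkey := Kernel.partialTraj_compProd_eq_map_traj (X := fun _ => ℕ × ℝ) (κ := B.step π)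
    (Nat.zero_le n) (x₀ := fun _ => (s₀, 0))
  have h1 : ∫⁻ ω, G (fun k => ω k) (ω (n + 1)) ∂(B.pathLaw π s₀)
      = ∫⁻ p, Function.uncurry G p ∂((B.pathLaw π s₀).map
          (fun x => (Preorder.frestrictLe (π := fun _ => ℕ × ℝ) n x, x (n + 1)))) := by
    rw [lintegral_map hG (by fun_prop)]
    rfl
  rw [h1, pathLaw, ← hkey, Measure.lintegral_compProd hG,
    ← Kernel.traj_map_frestrictLe_apply,
    lintegral_map hG.lintegral_kernel_prod_right' (by fun_prop)]
  rfl

lemma measurable_act_path (π : Policy) (n : ℕ) :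
    Measurable fun ω : ℕ → ℕ × ℝ => π.act n fun k => ω k :=
  (π.measurable_act n).comp (by fun_prop)

lemma pathLaw_zero (π : Policy) (s₀ : ℕ) : ∀ᵐ ω ∂(B.pathLaw π s₀), ω 0 = (s₀, 0) := by
  have h := Kernel.traj_map_frestrictLe_apply (X := fun _ => ℕ × ℝ) (κ := B.step π) 0 0
    (fun _ => (s₀, 0))
  rw [Kernel.partialTraj_self, Kernel.id_apply] at h
  have h2 : ∀ᵐ x ∂((B.pathLaw π s₀).map (Preorder.frestrictLe (π := fun _ => ℕ × ℝ) 0)),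
      x = fun _ => (s₀, 0) := by
    rw [pathLaw, h, ae_dirac_eq]
    simp
  filter_upwards [ae_of_ae_map (by fun_prop) h2] with ω hω
  exact congrFun hω ⟨0, by simp⟩

instance (π : Policy) (s₀ : ℕ) : IsProbabilityMeasure (B.pathLaw π s₀) := by
  unfold pathLaw
  infer_instance

end Service

/-! ### Time integrals as sums over events, and the Dynkin inequality -/

lemma eventTime_succ (ω : ℕ → ℕ × ℝ) (n : ℕ) :
    eventTime ω (n + 1) = eventTime ω n + (ω (n + 1)).2 :=
  Finset.sum_range_succ _ n

@[fun_prop]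
lemma measurable_eventTime (n : ℕ) : Measurable fun ω : ℕ → ℕ × ℝ => eventTime ω n := by
  unfold eventTime
  fun_prop

/-- Time of the last event of a history; the dummy time in entry `0` is not counted. -/
def History.time {n : ℕ} (x : History n) : ℝ :=
  ∑ k : Finset.Iic n, if (k : ℕ) = 0 then 0 else (x k).2

@[fun_prop]
lemma History.measurable_time {n : ℕ} : Measurable (History.time (n := n)) := by
  unfold History.time
  refine Finset.measurable_sum _ fun k _ => ?_
  split_ifs <;> fun_prop

lemma History.time_restrict (ω : ℕ → ℕ × ℝ) (n : ℕ) :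
    History.time (fun k : Finset.Iic n => ω k) = eventTime ω n := by
  rw [History.time, Finset.sum_coe_sort (Finset.Iic n) (fun k => if k = 0 then 0 else (ω k).2),
    ← Nat.range_succ_eq_Iic, Finset.sum_range_succ']
  simp [eventTime]

/-- Length of the part of the `n`-th sojourn interval that lies before the horizon `T`
(for nonnegative sojourn times). -/
def holdTime (T : ℝ) (ω : ℕ → ℕ × ℝ) (n : ℕ) : ℝ≥0∞ :=
  ENNReal.ofReal (min (T - eventTime ω n) (ω (n + 1)).2)

@[fun_prop]
lemma measurable_holdTime (T : ℝ) (n : ℕ) : Measurable fun ω => holdTime T ω n := by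
  unfold holdTime
  fun_prop

section Pathwise

variable {ω : ℕ → ℕ × ℝ}

lemma strictMono_eventTime (hω : ∀ n, 0 < (ω (n + 1)).2) : StrictMono (eventTime ω) :=
  strictMono_nat_of_lt_succ fun n => by rw [eventTime_succ]; linarith [hω n]

lemma eventTime_nonneg (hω : ∀ n, 0 < (ω (n + 1)).2) (n : ℕ) : 0 ≤ eventTime ω n :=
  Finset.sum_nonneg fun k _ => (hω k).le

lemma eventCount_eq (hω : ∀ n, 0 < (ω (n + 1)).2) {t : ℝ} {n : ℕ}
    (h1 : eventTime ω n ≤ t) (h2 : t < eventTime ω (n + 1)) : eventCount ω t = n := by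
  have : {k : ℕ | eventTime ω (k + 1) ≤ t} = (Finset.range n : Set ℕ) := by
    ext k
    simp only [Set.mem_ofPred_eq, Finset.coe_range, Set.mem_Iio]
    constructor
    · intro hk
      have := (strictMono_eventTime hω).lt_iff_lt.1 (hk.trans_lt h2)
      omega
    · intro hk
      exact ((strictMono_eventTime hω).monotone (by omega : k + 1 ≤ n)).trans h1
  rw [eventCount, this, Set.ncard_coe_finset, Finset.card_range]

lemma sum_holdTime_le (hω : ∀ n, 0 < (ω (n + 1)).2) {T : ℝ} (hT : 0 ≤ T) (n : ℕ) :
    ∑ k ∈ Finset.range n, holdTime T ω k ≤ ENNReal.ofReal T := by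
  have : ∑ k ∈ Finset.range n, holdTime T ω k = ENNReal.ofReal (min T (eventTime ω n)) := by
    induction n with
    | zero => simp [eventTime, hT]
    | succ n ih =>
      have h0 := eventTime_nonneg hω n
      have h1 := hω n
      rw [Finset.sum_range_succ, ih, eventTime_succ, holdTime]
      rcases le_total T (eventTime ω n) with h | h
      · rw [ENNReal.ofReal_of_nonpos (p := min (T - eventTime ω n) _)
          ((min_le_left _ _).trans (by linarith)), add_zero, min_eq_left h,
          min_eq_left (by linarith)]
      · rw [min_eq_right h, ← ENNReal.ofReal_add h0 (le_min (by linarith) h1.le),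
          ← min_add_add_left, add_sub_cancel]
  rw [this]
  exact ENNReal.ofReal_le_ofReal (min_le_left _ _)

/-- A time integral over `(0, T]` of a function of the number of past events splits over the
sojourn intervals, provided that only finitely many of them meet `(0, T]`. -/
lemma setLIntegral_eventCount (hω : ∀ n, 0 < (ω (n + 1)).2) {T : ℝ}
    (hN : ∃ N, T < eventTime ω N) (f : ℕ → ℝ≥0∞) :
    ∫⁻ t in Set.Ioc 0 T, f (eventCount ω t) = ∑' n, f n * holdTime T ω n := by
  have hmono := strictMono_eventTime hω
  set I : ℕ → Set ℝ := fun n => Set.Ico (eventTime ω n) (eventTime ω (n + 1)) ∩ Set.Ioc 0 T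
  have hImeas : ∀ n, MeasurableSet (I n) := fun n => measurableSet_Ico.inter measurableSet_Ioc
  have hcount : ∀ n, ∀ t ∈ I n, eventCount ω t = n := fun n t ht => eventCount_eq hω ht.1.1 ht.1.2
  have hunion : Set.Ioc 0 T = ⋃ n, I n := by
    refine Set.Subset.antisymm (fun t ht => ?_) (Set.iUnion_subset fun n => Set.inter_subset_right)
    obtain ⟨N, hN⟩ := hN
    have hex : ∃ m, t < eventTime ω m := ⟨N, ht.2.trans_lt hN⟩
    classical
    obtain ⟨m, hm⟩ : ∃ m, Nat.find hex = m + 1 := by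
      refine Nat.exists_eq_succ_of_ne_zero fun h0 => ?_
      have := Nat.find_spec hex
      rw [h0] at this
      exact absurd this (by simpa [eventTime] using ht.1.le)
    refine Set.mem_iUnion.2 ⟨m, ⟨not_lt.1 (Nat.find_min hex (by omega)), ?_⟩, ht⟩
    rw [← hm]
    exact Nat.find_spec hex
  have hdisj : Pairwise (Function.onFun Disjoint I) := by
    intro i j hij
    rw [Function.onFun, Set.disjoint_left]
    intro t hi hj
    exact hij ((hcount i t hi).symm.trans (hcount j t hj))
  rw [hunion, lintegral_iUnion hImeas hdisj]
  refine tsum_congr fun n => ?_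
  rw [setLIntegral_congr_fun (g := fun _ => f n) (hImeas n)
    (fun t ht => by simp only [hcount n t ht]), setLIntegral_const]
  congr 1
  have hae : I n =ᵐ[volume] (Set.Ioc (eventTime ω n) (eventTime ω (n + 1)) ∩ Set.Ioc 0 T : Set ℝ) :=
    Ico_ae_eq_Ioc.inter (ae_eq_refl _)
  rw [measure_congr hae, Set.Ioc_inter_Ioc, Real.volume_Ioc,
    sup_eq_left.2 (eventTime_nonneg hω n), inf_comm, eventTime_succ, holdTime]
  congr 1
  rw [← min_sub_sub_right, add_sub_cancel_left]

end Pathwise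

namespace Service

variable (B : Service)

/-- Expected time integral, over the part of the `n`-th sojourn interval before `T`, of the rate `φ`
depending on the state and the action. -/
def sojournCost (π : Policy) (s₀ : ℕ) (T : ℝ) (φ : ℕ → Bool → ℝ≥0∞) (n : ℕ) : ℝ≥0∞ :=
  ∫⁻ ω, φ (ω n).1 (π.act n fun k => ω k) * holdTime T ω n ∂(B.pathLaw π s₀)

/-- Expected value of the potential `h` at the `n`-th event, on the event that it happens up to
time `T`. -/
def killedPotential (π : Policy) (s₀ : ℕ) (T : ℝ) (h : ℕ → ℝ≥0∞) (n : ℕ) : ℝ≥0∞ :=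
  ∫⁻ ω, (if eventTime ω n ≤ T then h (ω n).1 else 0) ∂(B.pathLaw π s₀)

variable {B} {π : Policy} {s₀ : ℕ} {T : ℝ} {h : ℕ → ℝ≥0∞} {φ ψ : ℕ → Bool → ℝ≥0∞}

lemma measurable_rate (φ : ℕ → Bool → ℝ≥0∞) (π : Policy) (n : ℕ) :
    Measurable fun ω : ℕ → ℕ × ℝ => φ (ω n).1 (π.act n fun k => ω k) :=
  (measurable_of_countable (Function.uncurry φ)).comp
    ((measurable_fst.comp (measurable_pi_apply n)).prodMk (measurable_act_path π n))

lemma sojournCost_eq (π : Policy) (s₀ : ℕ) (T : ℝ) (φ : ℕ → Bool → ℝ≥0∞) (n : ℕ) :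
    B.sojournCost π s₀ T φ n = ∫⁻ ω, φ (ω n).1 (π.act n fun k => ω k) *
      (∫⁻ e, ENNReal.ofReal (min (T - eventTime ω n) e.2)
        ∂(B.eventLaw (ω n).1 (π.act n fun k => ω k))) ∂(B.pathLaw π s₀) := by
  have hG : Measurable (Function.uncurry fun (x : History n) (e : ℕ × ℝ) =>
      φ x.current (π.act n x) * ENNReal.ofReal (min (T - x.time) e.2)) := by
    refine Measurable.mul ?_ ((measurable_const.sub
      (History.measurable_time.comp measurable_fst)).min
      (measurable_snd.comp measurable_snd)).ennreal_ofReal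
    exact (measurable_of_countable (Function.uncurry φ)).comp
      ((History.measurable_current.comp measurable_fst).prodMk
        ((π.measurable_act n).comp measurable_fst))
  have := B.lintegral_pathLaw_succ π s₀ n hG
  simp only [History.time_restrict] at this
  refine this.trans (lintegral_congr fun ω => ?_)
  rw [lintegral_const_mul _ (by fun_prop)]
  rfl

lemma killedPotential_succ (π : Policy) (s₀ : ℕ) (T : ℝ) (h : ℕ → ℝ≥0∞) (n : ℕ) :
    B.killedPotential π s₀ T h (n + 1) = ∫⁻ ω, (∫⁻ e, ENNReal.ofReal (min (T - eventTime ω n) e.2)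
        ∂(B.eventLaw (ω n).1 (π.act n fun k => ω k))) *
      (ENNReal.ofReal (B.birthRate (ω n).1 (π.act n fun k => ω k)) * h ((ω n).1 + 1)
        + ENNReal.ofReal (B.deathRate (ω n).1 (π.act n fun k => ω k)) * h ((ω n).1 - 1))
      ∂(B.pathLaw π s₀) := by
  have hG : Measurable (Function.uncurry fun (x : History n) (e : ℕ × ℝ) =>
      if e.2 ≤ T - x.time then h e.1 else 0) := by
    refine Measurable.ite (measurableSet_le (by fun_prop) (by fun_prop)) ?_ measurable_const
    exact (measurable_of_countable h).comp (by fun_prop)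
  have := B.lintegral_pathLaw_succ π s₀ n hG
  simp only [History.time_restrict] at this
  rw [killedPotential]
  simp only [eventTime_succ, ← le_sub_iff_add_le']
  refine this.trans (lintegral_congr fun ω => ?_)
  rw [lintegral_eventLaw_potential]

lemma lintegral_eventLaw_min_mul_le (s : ℕ) (a : Bool) (r : ℝ) :
    (∫⁻ e, ENNReal.ofReal (min r e.2) ∂(B.eventLaw s a)) * ENNReal.ofReal (B.totalRate s a)
      ≤ if 0 ≤ r then 1 else 0 := by
  have := isProbabilityMeasure_expMeasure (B.totalRate_pos s a)
  rw [lintegral_eventLaw_min, mul_comm, ← expMeasure_Iic (B.totalRate_pos s a)]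
  split_ifs with hr
  · exact prob_le_one
  · rw [← expMeasure_Iic_zero (B.totalRate_pos s a)]
    exact measure_mono (Set.Iic_subset_Iic.2 (not_le.1 hr).le)

/-- One-event form of the drift inequality: if the generator of the controlled process satisfies
`φ + L h ≤ ψ` along the policy, with the negative part of `L h` moved to the right-hand side, then
the killed potential and the sojourn costs satisfy the corresponding inequality. -/
lemma sojournCost_add_killedPotential_le (n : ℕ)
    (hdrift : ∀ x : History n, φ x.current (π.act n x)
      + (ENNReal.ofReal (B.birthRate x.current (π.act n x)) * h (x.current + 1)
        + ENNReal.ofReal (B.deathRate x.current (π.act n x)) * h (x.current - 1))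
      ≤ ENNReal.ofReal (B.totalRate x.current (π.act n x)) * h x.current
        + ψ x.current (π.act n x)) :
    B.sojournCost π s₀ T φ n + B.killedPotential π s₀ T h (n + 1)
      ≤ B.killedPotential π s₀ T h n + B.sojournCost π s₀ T ψ n := by
  have hmp : Measurable fun ω : ℕ → ℕ × ℝ => if eventTime ω n ≤ T then h (ω n).1 else 0 :=
    Measurable.ite (measurableSet_le (by fun_prop) (by fun_prop))
      ((measurable_of_countable h).comp (by fun_prop)) measurable_const
  rw [sojournCost_eq, sojournCost_eq, killedPotential_succ, killedPotential,
    ← lintegral_add_left hmp]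
  refine (le_lintegral_add _ _).trans (lintegral_mono fun ω => ?_)
  set m := ∫⁻ e, ENNReal.ofReal (min (T - eventTime ω n) e.2)
    ∂(B.eventLaw (ω n).1 (π.act n fun k => ω k)) with hm
  have hx := hdrift fun k => ω k
  have hcur : History.current (fun k : Finset.Iic n => ω k) = (ω n).1 := rfl
  rw [hcur] at hx
  have h1 := lintegral_eventLaw_min_mul_le (B := B) (ω n).1 (π.act n fun k => ω k)
    (T - eventTime ω n)
  rw [← hm] at h1
  calc _ = m * (φ (ω n).1 (π.act n fun k => ω k)
        + (ENNReal.ofReal (B.birthRate (ω n).1 (π.act n fun k => ω k)) * h ((ω n).1 + 1)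
        + ENNReal.ofReal (B.deathRate (ω n).1 (π.act n fun k => ω k)) * h ((ω n).1 - 1))) := by
        ring
    _ ≤ m * (ENNReal.ofReal (B.totalRate (ω n).1 (π.act n fun k => ω k)) * h (ω n).1
        + ψ (ω n).1 (π.act n fun k => ω k)) := by gcongr
    _ = m * ENNReal.ofReal (B.totalRate (ω n).1 (π.act n fun k => ω k)) * h (ω n).1
        + ψ (ω n).1 (π.act n fun k => ω k) * m := by ring
    _ ≤ (if 0 ≤ T - eventTime ω n then 1 else 0) * h (ω n).1
        + ψ (ω n).1 (π.act n fun k => ω k) * m := by gcongr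
    _ = _ := by
        simp only [sub_nonneg, ite_mul, one_mul, zero_mul]

/-- Discrete Dynkin inequality: summing the one-event inequality over all events. -/
lemma tsum_sojournCost_le (hT : 0 ≤ T)
    (hdrift : ∀ n (x : History n), φ x.current (π.act n x)
      + (ENNReal.ofReal (B.birthRate x.current (π.act n x)) * h (x.current + 1)
        + ENNReal.ofReal (B.deathRate x.current (π.act n x)) * h (x.current - 1))
      ≤ ENNReal.ofReal (B.totalRate x.current (π.act n x)) * h x.current
        + ψ x.current (π.act n x)) :
    ∑' n, B.sojournCost π s₀ T φ n ≤ h s₀ + ∑' n, B.sojournCost π s₀ T ψ n := by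
  have hzero : B.killedPotential π s₀ T h 0 = h s₀ := by
    have : ∀ᵐ ω ∂(B.pathLaw π s₀), (if eventTime ω 0 ≤ T then h (ω 0).1 else 0) = h s₀ := by
      filter_upwards [B.pathLaw_zero π s₀] with ω hω
      simp [eventTime, hT, hω]
    rw [killedPotential, lintegral_congr_ae this]
    simp
  have hsum : ∀ n, ∑ k ∈ Finset.range n, B.sojournCost π s₀ T φ k + B.killedPotential π s₀ T h n
      ≤ h s₀ + ∑ k ∈ Finset.range n, B.sojournCost π s₀ T ψ k := by
    intro n
    induction n with
    | zero => simp [hzero]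
    | succ n ih =>
      rw [Finset.sum_range_succ, Finset.sum_range_succ, add_assoc]
      calc _ ≤ ∑ k ∈ Finset.range n, B.sojournCost π s₀ T φ k
              + (B.killedPotential π s₀ T h n + B.sojournCost π s₀ T ψ n) := by
            exact add_le_add_right (sojournCost_add_killedPotential_le n (hdrift n)) _
        _ ≤ _ := by
            rw [← add_assoc, ← add_assoc]
            gcongr
  refine ENNReal.tsum_le_of_sum_range_le fun n => ?_
  exact le_self_add.trans ((hsum n).trans (by gcongr; exact ENNReal.sum_le_tsum _))

variable (B π s₀)

lemma ae_sojourn_pos : ∀ᵐ ω ∂(B.pathLaw π s₀), ∀ n, 0 < (ω (n + 1)).2 := by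
  rw [ae_all_iff]
  intro n
  have hG : Measurable (Function.uncurry fun (_ : History n) (e : ℕ × ℝ) =>
      if e.2 ≤ 0 then (1 : ℝ≥0∞) else 0) :=
    Measurable.ite (measurableSet_le (by fun_prop) (by fun_prop)) measurable_const measurable_const
  have h := B.lintegral_pathLaw_succ π s₀ n hG
  have h0 : ∀ s a, ∫⁻ e, (if e.2 ≤ 0 then (1 : ℝ≥0∞) else 0) ∂(B.eventLaw s a) = 0 := by
    intro s a
    have hmin : ∀ e : ℕ × ℝ, ENNReal.ofReal (min 0 e.2) = 0 := fun e =>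
      ENNReal.ofReal_of_nonpos (min_le_left 0 e.2)
    rw [lintegral_eventLaw_potential B s a 0 (fun _ => 1)]
    simp [hmin]
  simp only [h0, lintegral_zero] at h
  have hm : Measurable fun ω : ℕ → ℕ × ℝ => if (ω (n + 1)).2 ≤ 0 then (1 : ℝ≥0∞) else 0 :=
    Measurable.ite (measurableSet_le (by fun_prop) (by fun_prop)) measurable_const measurable_const
  filter_upwards [(lintegral_eq_zero_iff hm).1 h] with ω hω
  by_contra hneg
  simp [not_lt.1 hneg] at hω

lemma tsum_sojournCost_one_le (hT : 0 ≤ T) :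
    ∑' n, B.sojournCost π s₀ T (fun _ _ => 1) n ≤ ENNReal.ofReal T := by
  refine ENNReal.tsum_le_of_sum_range_le fun n => ?_
  simp only [sojournCost, one_mul]
  rw [← lintegral_finsetSum _ (fun k _ => measurable_holdTime T k)]
  calc _ ≤ ∫⁻ _, ENNReal.ofReal T ∂(B.pathLaw π s₀) :=
        lintegral_mono_ae (by
          filter_upwards [B.ae_sojourn_pos π s₀] with ω hω
          exact sum_holdTime_le hω hT n)
    _ = _ := by simp

/-- The process does not explode: the potential `h s = s` shows that the expected number of events
up to time `T` is at most `s₀ + 2 λ T`. -/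
lemma ae_exists_lt_eventTime (hT : 0 ≤ T) :
    ∀ᵐ ω ∂(B.pathLaw π s₀), ∃ N, T < eventTime ω N := by
  have hprob : ∀ n, B.pathLaw π s₀ {ω | eventTime ω (n + 1) ≤ T}
      = B.sojournCost π s₀ T (fun s a => ENNReal.ofReal (B.totalRate s a)) n := by
    intro n
    have h1 := B.killedPotential_succ π s₀ T (fun _ => 1) n
    rw [sojournCost_eq]
    refine Eq.trans ?_ (h1.trans (lintegral_congr fun ω => ?_))
    · rw [killedPotential, ← lintegral_indicator_one (measurableSet_le (by fun_prop) (by fun_prop))]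
      exact lintegral_congr fun ω => by simp [Set.indicator_apply]
    · rw [mul_one, mul_one, ← ENNReal.ofReal_add (B.birthRate_pos _ _).le (B.deathRate_nonneg _ _),
        mul_comm]
      rfl
  have hle : ∑' n, B.sojournCost π s₀ T (fun s a => ENNReal.ofReal (B.totalRate s a)) n
      ≤ (s₀ : ℝ≥0∞) + ∑' n, B.sojournCost π s₀ T (fun _ _ => ENNReal.ofReal (2 * B.arr)) n := by
    refine tsum_sojournCost_le (h := fun s => (s : ℝ≥0∞)) hT fun n x => ?_
    generalize x.current = s
    generalize π.act n x = a
    have hd := B.deathRate_nonneg s a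
    have hb := B.birthRate_pos s a
    have hq := B.totalRate_pos s a
    simp only [← ENNReal.ofReal_natCast]
    rw [← ENNReal.ofReal_mul hb.le, ← ENNReal.ofReal_mul hd, ← ENNReal.ofReal_mul hq.le,
      ← ENNReal.ofReal_add (by positivity) (by positivity),
      ← ENNReal.ofReal_add (by positivity) (by positivity),
      ← ENNReal.ofReal_add (by positivity) (by linarith [B.arr_pos])]
    refine ENNReal.ofReal_le_ofReal ?_
    rcases s with _ | s
    · have : B.deathRate 0 a = 0 := by simp [deathRate]
      simp [totalRate, this, birthRate]
      linarith
    · simp only [totalRate, birthRate, Nat.add_sub_cancel]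
      push_cast
      linarith
  have hfin : ∑' n, B.sojournCost π s₀ T (fun _ _ => ENNReal.ofReal (2 * B.arr)) n
      ≤ ENNReal.ofReal (2 * B.arr) * ENNReal.ofReal T := by
    have : ∀ n, B.sojournCost π s₀ T (fun _ _ => ENNReal.ofReal (2 * B.arr)) n
        = ENNReal.ofReal (2 * B.arr) * B.sojournCost π s₀ T (fun _ _ => 1) n := by
      intro n
      simp only [sojournCost, one_mul]
      rw [lintegral_const_mul _ (measurable_holdTime T n)]
    simp only [this, ENNReal.tsum_mul_left]
    gcongr
    exact B.tsum_sojournCost_one_le π s₀ hT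
  have hne : ∑' n, B.pathLaw π s₀ {ω | eventTime ω (n + 1) ≤ T} ≠ ⊤ := by
    simp only [hprob]
    refine ((hle.trans (add_le_add_right hfin _)).trans_lt ?_).ne
    exact ENNReal.add_lt_top.2 ⟨ENNReal.natCast_lt_top _,
      ENNReal.mul_lt_top ENNReal.ofReal_lt_top ENNReal.ofReal_lt_top⟩
  filter_upwards [ae_eventually_notMem hne] with ω hω
  obtain ⟨N, hN⟩ := hω.exists
  exact ⟨N + 1, not_le.1 hN⟩

/-- Expected time integral over `(0, T]` of a rate depending on state and action. -/
lemma lintegral_rate_eq_tsum (hT : 0 ≤ T) (φ : ℕ → Bool → ℝ≥0∞) :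
    ∫⁻ ω, (∫⁻ t in Set.Ioc 0 T, φ (stateAt ω t) (actionAt π ω t)) ∂(B.pathLaw π s₀)
      = ∑' n, B.sojournCost π s₀ T φ n := by
  simp only [sojournCost]
  refine Eq.trans (lintegral_congr_ae ?_) (lintegral_tsum fun n =>
    ((measurable_rate φ π n).mul (measurable_holdTime T n)).aemeasurable)
  filter_upwards [B.ae_sojourn_pos π s₀, B.ae_exists_lt_eventTime π s₀ hT] with ω h1 h2
  exact setLIntegral_eventCount h1 h2 fun n => φ (ω n).1 (π.act n fun k => ω k)

lemma tsum_sojournCost_one (hT : 0 ≤ T) :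
    ∑' n, B.sojournCost π s₀ T (fun _ _ => 1) n = ENNReal.ofReal T := by
  rw [← lintegral_rate_eq_tsum B π s₀ hT]
  simp

lemma tsum_sojournCost_cost (hT : 0 ≤ T) :
    ∑' n, B.sojournCost π s₀ T (fun s a => ENNReal.ofReal (B.cost s a)) n
      = B.expectedCost π s₀ T :=
  (lintegral_rate_eq_tsum B π s₀ hT _).symm

lemma tsum_sojournCost_passive (hT : 0 ≤ T) :
    ∑' n, B.sojournCost π s₀ T (fun _ a => if a then 0 else 1) n
      = B.expectedPassiveTime π s₀ T :=
  (lintegral_rate_eq_tsum B π s₀ hT _).symm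

lemma tsum_sojournCost_add (φ ψ : ℕ → Bool → ℝ≥0∞) :
    ∑' n, B.sojournCost π s₀ T (fun s a => φ s a + ψ s a) n
      = ∑' n, B.sojournCost π s₀ T φ n + ∑' n, B.sojournCost π s₀ T ψ n := by
  rw [← ENNReal.tsum_add]
  refine tsum_congr fun n => ?_
  simp only [sojournCost, add_mul]
  exact lintegral_add_left ((measurable_rate φ π n).mul (measurable_holdTime T n)) _

lemma tsum_sojournCost_const_mul (c : ℝ≥0∞) (φ : ℕ → Bool → ℝ≥0∞) :
    ∑' n, B.sojournCost π s₀ T (fun s a => c * φ s a) n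
      = c * ∑' n, B.sojournCost π s₀ T φ n := by
  rw [← ENNReal.tsum_mul_left]
  refine tsum_congr fun n => ?_
  simp only [sojournCost, mul_assoc]
  exact lintegral_const_mul _ ((measurable_rate φ π n).mul (measurable_holdTime T n))

end Service

/-! ### Verification bounds for the average cost -/

namespace Service

variable (B : Service)

/-- Generator of the controlled process, with action `a` in force, applied to the potential `h`. -/
def generator (h : ℕ → ℝ) (s : ℕ) (a : Bool) : ℝ :=
  B.birthRate s a * (h (s + 1) - h s) + B.deathRate s a * (h (s - 1) - h s)

/-- Net cost rate `C(s, a) - W (1 - a)` under the subsidy `W`. -/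
def netCost (W : ℝ) (s : ℕ) (a : Bool) : ℝ := B.cost s a - W * (if a then 0 else 1)

variable {B} {π : Policy} {W g T : ℝ} {h : ℕ → ℝ}

lemma passive_nonneg (a : Bool) : (0 : ℝ) ≤ if a then 0 else 1 := by split_ifs <;> simp

lemma cost_nonneg (s : ℕ) (a : Bool) : 0 ≤ B.cost s a :=
  div_nonneg (Nat.cast_nonneg s) B.arr_pos.le

/-- The discrete Dynkin inequality in terms of real rates and a real potential. -/
lemma tsum_sojournCost_le_of_real (hT : 0 ≤ T) (s₀ : ℕ) {φ ψ : ℕ → Bool → ℝ}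
    (hφ : ∀ s a, 0 ≤ φ s a) (hψ : ∀ s a, 0 ≤ ψ s a) (hh : ∀ s, 0 ≤ h s)
    (hdrift : ∀ n (x : History n), φ x.current (π.act n x) + B.generator h x.current (π.act n x)
      ≤ ψ x.current (π.act n x)) :
    ∑' n, B.sojournCost π s₀ T (fun s a => ENNReal.ofReal (φ s a)) n
      ≤ ENNReal.ofReal (h s₀)
        + ∑' n, B.sojournCost π s₀ T (fun s a => ENNReal.ofReal (ψ s a)) n := by
  refine tsum_sojournCost_le (h := fun s => ENNReal.ofReal (h s)) hT fun n x => ?_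
  have hx := hdrift n x
  revert hx
  generalize x.current = s
  generalize π.act n x = a
  intro hx
  have hd := B.deathRate_nonneg s a
  have hb := (B.birthRate_pos s a).le
  have hq := (B.totalRate_pos s a).le
  have h0 := hh s
  have h1 := hh (s + 1)
  have h2 := hh (s - 1)
  have h3 := hφ s a
  have h4 := hψ s a
  rw [← ENNReal.ofReal_mul hb, ← ENNReal.ofReal_mul hd, ← ENNReal.ofReal_mul hq,
    ← ENNReal.ofReal_add (by positivity) (by positivity),
    ← ENNReal.ofReal_add h3 (by positivity), ← ENNReal.ofReal_add (by positivity) h4]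
  refine ENNReal.ofReal_le_ofReal ?_
  simp only [generator] at hx
  simp only [totalRate]
  linarith

lemma tsum_sojournCost_affine (π : Policy) (s₀ : ℕ) (hT : 0 ≤ T) {α β : ℝ} (hα : 0 ≤ α)
    (hβ : 0 ≤ β) :
    ∑' n, B.sojournCost π s₀ T (fun _ a => ENNReal.ofReal (α * (if a then 0 else 1) + β)) n
      = ENNReal.ofReal α * B.expectedPassiveTime π s₀ T + ENNReal.ofReal β * ENNReal.ofReal T := by
  rw [← tsum_sojournCost_passive B π s₀ hT, ← tsum_sojournCost_one B π s₀ hT,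
    ← tsum_sojournCost_const_mul, ← tsum_sojournCost_const_mul, ← tsum_sojournCost_add]
  refine tsum_congr fun n => congrArg (fun f => B.sojournCost π s₀ T f n)
    (funext fun s => funext fun a => ?_)
  rw [ENNReal.ofReal_add (mul_nonneg hα (passive_nonneg a)) hβ, ENNReal.ofReal_mul hα, mul_one]
  congr 2
  split_ifs <;> simp

lemma tsum_sojournCost_cost_add (π : Policy) (s₀ : ℕ) (hT : 0 ≤ T) {α β : ℝ} (hα : 0 ≤ α)
    (hβ : 0 ≤ β) :
    ∑' n, B.sojournCost π s₀ T
        (fun s a => ENNReal.ofReal (B.cost s a + (α * (if a then 0 else 1) + β))) n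
      = B.expectedCost π s₀ T + (ENNReal.ofReal α * B.expectedPassiveTime π s₀ T
        + ENNReal.ofReal β * ENNReal.ofReal T) := by
  rw [← tsum_sojournCost_affine π s₀ hT hα hβ, ← tsum_sojournCost_cost B π s₀ hT,
    ← tsum_sojournCost_add]
  refine tsum_congr fun n => congrArg (fun f => B.sojournCost π s₀ T f n)
    (funext fun s => funext fun a => ?_)
  exact ENNReal.ofReal_add (cost_nonneg s a)
    (add_nonneg (mul_nonneg hα (passive_nonneg a)) hβ)

lemma expectedPassiveTime_ne_top (π : Policy) (s₀ : ℕ) (hT : 0 ≤ T) :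
    B.expectedPassiveTime π s₀ T ≠ ⊤ := by
  refine ne_top_of_le_ne_top (ENNReal.ofReal_ne_top (r := T)) ?_
  rw [← tsum_sojournCost_passive B π s₀ hT, ← tsum_sojournCost_one B π s₀ hT]
  refine ENNReal.tsum_le_tsum fun n => lintegral_mono fun ω => ?_
  dsimp only
  gcongr
  split_ifs <;> simp

/-- Verification, upper bound over a finite horizon: a nonnegative potential that makes the drift
of the net cost at most `g`. Signs of `W` and `g` are split off to work with nonnegative rates. -/
lemma expectedCost_le (hT : 0 ≤ T) (s₀ : ℕ) (hh : ∀ s, 0 ≤ h s)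
    (hdrift : ∀ n (x : History n),
      B.netCost W x.current (π.act n x) + B.generator h x.current (π.act n x) ≤ g) :
    B.expectedCost π s₀ T ≠ ⊤ ∧
      (B.expectedCost π s₀ T).toReal - W * (B.expectedPassiveTime π s₀ T).toReal
        ≤ h s₀ + g * T := by
  have hW := max_zero_sub_eq_self W
  have hg := max_zero_sub_eq_self g
  have hW1 := le_max_right W 0
  have hW2 := le_max_right (-W) 0
  have hg1 := le_max_right g 0
  have hg2 := le_max_right (-g) 0
  have key := tsum_sojournCost_le_of_real (B := B) (π := π) (h := h) hT s₀
    (φ := fun s a => B.cost s a + (max (-W) 0 * (if a then 0 else 1) + max (-g) 0))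
    (ψ := fun _ a => max W 0 * (if a then 0 else 1) + max g 0)
    (fun s a => add_nonneg (cost_nonneg s a) (add_nonneg (mul_nonneg hW2 (passive_nonneg a)) hg2))
    (fun s a => add_nonneg (mul_nonneg hW1 (passive_nonneg a)) hg1) hh
    (fun n x => by
      have := hdrift n x
      simp only [netCost] at this
      linear_combination this - (if π.act n x then 0 else 1) * hW - hg)
  rw [tsum_sojournCost_cost_add π s₀ hT hW2 hg2, tsum_sojournCost_affine π s₀ hT hW1 hg1] at key
  have hP := expectedPassiveTime_ne_top (B := B) π s₀ hT
  have hfin : ENNReal.ofReal (h s₀) + (ENNReal.ofReal (max W 0) * B.expectedPassiveTime π s₀ T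
      + ENNReal.ofReal (max g 0) * ENNReal.ofReal T) ≠ ⊤ := by finiteness
  have hC : B.expectedCost π s₀ T ≠ ⊤ := ne_top_of_le_ne_top hfin (le_self_add.trans key)
  refine ⟨hC, ?_⟩
  have := ENNReal.toReal_mono hfin key
  rw [ENNReal.toReal_add hC (by finiteness), ENNReal.toReal_add (by finiteness) (by finiteness),
    ENNReal.toReal_add (by finiteness) (by finiteness),
    ENNReal.toReal_add (by finiteness) (by finiteness)] at this
  simp only [ENNReal.toReal_mul, ENNReal.toReal_ofReal hT, ENNReal.toReal_ofReal hW1,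
    ENNReal.toReal_ofReal hW2, ENNReal.toReal_ofReal hg1, ENNReal.toReal_ofReal hg2,
    ENNReal.toReal_ofReal (hh s₀)] at this
  linear_combination this + (B.expectedPassiveTime π s₀ T).toReal * hW + T * hg

/-- Verification, lower bound over a finite horizon: a potential that is bounded above and makes
the drift of the net cost at least `g`. -/
lemma le_expectedCost (hT : 0 ≤ T) (s₀ : ℕ) {M : ℝ} (hh : ∀ s, h s ≤ M)
    (hdrift : ∀ n (x : History n),
      g ≤ B.netCost W x.current (π.act n x) + B.generator h x.current (π.act n x))
    (hC : B.expectedCost π s₀ T ≠ ⊤) :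
    h s₀ - M + g * T
      ≤ (B.expectedCost π s₀ T).toReal - W * (B.expectedPassiveTime π s₀ T).toReal := by
  have hW := max_zero_sub_eq_self W
  have hg := max_zero_sub_eq_self g
  have hW1 := le_max_right W 0
  have hW2 := le_max_right (-W) 0
  have hg1 := le_max_right g 0
  have hg2 := le_max_right (-g) 0
  have key := tsum_sojournCost_le_of_real (B := B) (π := π) (h := fun s => M - h s) hT s₀
    (φ := fun _ a => max W 0 * (if a then 0 else 1) + max g 0)
    (ψ := fun s a => B.cost s a + (max (-W) 0 * (if a then 0 else 1) + max (-g) 0))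
    (fun s a => add_nonneg (mul_nonneg hW1 (passive_nonneg a)) hg1)
    (fun s a => add_nonneg (cost_nonneg s a) (add_nonneg (mul_nonneg hW2 (passive_nonneg a)) hg2))
    (fun s => sub_nonneg.2 (hh s))
    (fun n x => by
      have := hdrift n x
      simp only [netCost, generator] at this ⊢
      linear_combination this + (if π.act n x then 0 else 1) * hW + hg)
  rw [tsum_sojournCost_cost_add π s₀ hT hW2 hg2, tsum_sojournCost_affine π s₀ hT hW1 hg1] at key
  have hP := expectedPassiveTime_ne_top (B := B) π s₀ hT
  have := ENNReal.toReal_mono (by finiteness) key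
  rw [ENNReal.toReal_add (by finiteness) (by finiteness),
    ENNReal.toReal_add (by finiteness) (by finiteness),
    ENNReal.toReal_add hC (by finiteness),
    ENNReal.toReal_add (by finiteness) (by finiteness)] at this
  simp only [ENNReal.toReal_mul, ENNReal.toReal_ofReal hT, ENNReal.toReal_ofReal hW1,
    ENNReal.toReal_ofReal hW2, ENNReal.toReal_ofReal hg1, ENNReal.toReal_ofReal hg2,
    ENNReal.toReal_ofReal (sub_nonneg.2 (hh s₀))] at this
  linear_combination this - (B.expectedPassiveTime π s₀ T).toReal * hW - T * hg

lemma coe_avgCost_integrand (s₀ : ℕ) (hC : B.expectedCost π s₀ T ≠ ⊤) :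
    ((B.expectedCost π s₀ T : EReal) - ((W * (B.expectedPassiveTime π s₀ T).toReal : ℝ) : EReal))
      / (T : EReal) = ((((B.expectedCost π s₀ T).toReal
        - W * (B.expectedPassiveTime π s₀ T).toReal) / T : ℝ) : EReal) := by
  rw [EReal.coe_div, EReal.coe_sub, EReal.coe_ennreal_toReal hC]

lemma tendsto_add_div_atTop (c g : ℝ) :
    Tendsto (fun T : ℝ => (((c + g * T) / T : ℝ) : EReal)) atTop (nhds (g : EReal)) := by
  refine (continuous_coe_real_ereal.tendsto g).comp ?_
  have : Tendsto (fun T : ℝ => c / T + g) atTop (nhds (0 + g)) :=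
    (tendsto_const_nhds.div_atTop tendsto_id).add_const g
  rw [zero_add] at this
  refine this.congr' ?_
  filter_upwards [eventually_gt_atTop 0] with T hT
  field_simp

lemma avgCost_le (s₀ : ℕ) (hh : ∀ s, 0 ≤ h s)
    (hdrift : ∀ n (x : History n),
      B.netCost W x.current (π.act n x) + B.generator h x.current (π.act n x) ≤ g) :
    B.avgCost W π s₀ ≤ g := by
  rw [← (tendsto_add_div_atTop (h s₀) g).limsup_eq]
  refine limsup_le_limsup ?_
  filter_upwards [eventually_gt_atTop 0] with T hT
  obtain ⟨hC, hle⟩ := expectedCost_le hT.le s₀ hh hdrift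
  rw [coe_avgCost_integrand s₀ hC, EReal.coe_le_coe_iff]
  gcongr

lemma le_avgCost (s₀ : ℕ) {M : ℝ} (hh : ∀ s, h s ≤ M)
    (hdrift : ∀ n (x : History n),
      g ≤ B.netCost W x.current (π.act n x) + B.generator h x.current (π.act n x)) :
    (g : EReal) ≤ B.avgCost W π s₀ := by
  rw [← (tendsto_add_div_atTop (h s₀ - M) g).limsup_eq]
  refine limsup_le_limsup ?_
  filter_upwards [eventually_gt_atTop 0] with T hT
  by_cases hC : B.expectedCost π s₀ T = ⊤
  · rw [hC, EReal.coe_ennreal_top, EReal.top_sub_coe,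
      EReal.top_div_of_pos_ne_top (EReal.coe_pos.2 hT) (EReal.coe_ne_top T)]
    exact le_top
  · rw [coe_avgCost_integrand s₀ hC, EReal.coe_le_coe_iff]
    have := le_expectedCost hT.le s₀ hh hdrift hC
    gcongr

end Service

/-! ### Threshold policies, optimality and indexability -/

namespace Service

variable (B : Service)

/-- Reciprocal of the stationary probability of the state `n` for the process that is passive in
`n` and active above it: `∑ k, ρ ^ k n! / (n + k)!` with `ρ = λ / μ`. -/
def invPassiveProb (n : ℕ) : ℝ := ∑' k : ℕ, (B.arr / B.srv) ^ k / ((n + 1).ascFactorial k : ℝ)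

lemma arr_div_srv_pos : 0 < B.arr / B.srv := div_pos B.arr_pos B.srv_pos

lemma invPassiveProb_term_anti {m n : ℕ} (h : m ≤ n) (k : ℕ) :
    (B.arr / B.srv) ^ k / ((n + 1).ascFactorial k : ℝ)
      ≤ (B.arr / B.srv) ^ k / ((m + 1).ascFactorial k : ℝ) := by
  have := B.arr_div_srv_pos
  have hpos : (0 : ℝ) < ((m + 1).ascFactorial k : ℝ) := by exact_mod_cast Nat.ascFactorial_pos _ _
  gcongr

lemma summable_invPassiveProb (n : ℕ) :
    Summable fun k : ℕ => (B.arr / B.srv) ^ k / ((n + 1).ascFactorial k : ℝ) := by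
  have h := B.arr_div_srv_pos
  refine Summable.of_nonneg_of_le (fun k => by positivity)
    (fun k => B.invPassiveProb_term_anti (Nat.zero_le n) k) ?_
  simpa [Nat.one_ascFactorial] using Real.summable_pow_div_factorial (B.arr / B.srv)

lemma invPassiveProb_eq (n : ℕ) :
    B.invPassiveProb n = 1 + B.arr / B.srv / (n + 1) * B.invPassiveProb (n + 1) := by
  rw [invPassiveProb, (B.summable_invPassiveProb n).tsum_eq_zero_add, invPassiveProb,
    ← tsum_mul_left]
  congr 1
  · simp
  · refine tsum_congr fun k => ?_
    have h : (n + 1).ascFactorial (k + 1) = (n + 1) * (n + 1 + 1).ascFactorial k := by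
      rw [Nat.ascFactorial_succ, Nat.succ_ascFactorial]
    have hpos : ((n + 1 + 1).ascFactorial k : ℝ) ≠ 0 := by
      exact_mod_cast (Nat.ascFactorial_pos _ _).ne'
    rw [h]
    push_cast
    field_simp
    ring

lemma strictAnti_invPassiveProb : StrictAnti B.invPassiveProb := by
  intro m n hmn
  have h := B.arr_div_srv_pos
  refine (B.summable_invPassiveProb n).tsum_lt_tsum (i := 1)
    (fun k => B.invPassiveProb_term_anti hmn.le k) ?_ (B.summable_invPassiveProb m)
  simp only [pow_one, Nat.ascFactorial_succ, Nat.ascFactorial_zero]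
  push_cast
  gcongr

lemma one_le_invPassiveProb (n : ℕ) : 1 ≤ B.invPassiveProb n := by
  have h := B.arr_div_srv_pos
  have h2 : 0 ≤ B.invPassiveProb (n + 1) := tsum_nonneg fun k => by positivity
  rw [invPassiveProb_eq]
  have : 0 ≤ B.arr / B.srv / (n + 1) * B.invPassiveProb (n + 1) := by positivity
  linarith

lemma tendsto_invPassiveProb : Tendsto B.invPassiveProb atTop (nhds 1) := by
  have h := B.arr_div_srv_pos
  refine tendsto_of_tendsto_of_tendsto_of_le_of_le (g := fun _ => 1)
    (h := fun n : ℕ => 1 + B.arr / B.srv * B.invPassiveProb 0 * (1 / ((n : ℝ) + 1)))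
    tendsto_const_nhds ?_ (fun n => B.one_le_invPassiveProb n) (fun n => ?_)
  · have := (tendsto_one_div_add_atTop_nhds_zero_nat (𝕜 := ℝ)).const_mul
      (B.arr / B.srv * B.invPassiveProb 0)
    simpa using this.const_add 1
  · have h1 := B.strictAnti_invPassiveProb.antitone (Nat.zero_le (n + 1))
    rw [B.invPassiveProb_eq n]
    dsimp only
    calc _ ≤ 1 + B.arr / B.srv / (n + 1) * B.invPassiveProb 0 := by gcongr
      _ = _ := by ring

/-- Long-run fraction of time spent passive under the threshold policy that is passive exactly in
the states below `m`. -/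
def passiveFraction : ℕ → ℝ
  | 0 => 0
  | n + 1 => 1 / B.invPassiveProb n

lemma strictMono_passiveFraction : StrictMono B.passiveFraction := by
  refine strictMono_nat_of_lt_succ fun m => ?_
  have h1 := fun n => zero_lt_one.trans_le (B.one_le_invPassiveProb n)
  rcases m with _ | n
  · exact one_div_pos.2 (h1 0)
  · exact one_div_lt_one_div_of_lt (h1 _) (B.strictAnti_invPassiveProb n.lt_succ_self)

/-- Average net cost of the threshold policy that is passive exactly in the states below `m`: the
mean state is `λ / μ` plus the lowest recurrent state `m - 1` times its probability, and the latter
is also the fraction of time for which the subsidy is received. -/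
def thresholdCost (W : ℝ) (m : ℕ) : ℝ :=
  1 / B.srv + (((m : ℝ) - 1) / B.arr - W) * B.passiveFraction m

/-- Increments of the solution of Poisson's equation for the threshold `m`, on its recurrent
states. -/
def thresholdSlope (W : ℝ) (m s : ℕ) : ℝ :=
  1 / (B.arr * B.srv) + (1 / B.srv - B.thresholdCost W m) * (B.invPassiveProb s - 1) / B.arr

/-- Poisson's equation in the active states; in state `0` there is no death term, and the equation
determines the constant for the policy that is always active. -/
lemma thresholdSlope_active (W : ℝ) {m s : ℕ} (h : s ≠ 0 ∨ m = 0) :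
    B.arr * B.thresholdSlope W m s
      = B.thresholdCost W m - s / B.arr + B.srv * s * B.thresholdSlope W m (s - 1) := by
  have h1 := B.arr_pos.ne'
  have h2 := B.srv_pos.ne'
  rcases s with _ | n
  · have hm : m = 0 := by simpa using h
    subst hm
    simp [thresholdSlope, thresholdCost, passiveFraction]
    field_simp
  · rw [thresholdSlope, thresholdSlope, Nat.add_sub_cancel, B.invPassiveProb_eq n]
    have h3 : (n : ℝ) + 1 ≠ 0 := by positivity
    push_cast
    field_simp
    ring

/-- Poisson's equation in the lowest recurrent state, which is passive; it determines the
constant. -/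
lemma thresholdSlope_passive (W : ℝ) (n : ℕ) :
    B.arr * B.thresholdSlope W (n + 1) n = B.thresholdCost W (n + 1) - n / B.arr + W := by
  have h1 := B.arr_pos.ne'
  have h2 := B.srv_pos.ne'
  have h3 := (zero_lt_one.trans_le (B.one_le_invPassiveProb n)).ne'
  simp only [thresholdSlope, thresholdCost, passiveFraction]
  push_cast
  field_simp
  ring

lemma tendsto_thresholdSlope (W : ℝ) (m : ℕ) :
    Tendsto (B.thresholdSlope W m) atTop (nhds (1 / (B.arr * B.srv))) := by
  have := ((((B.tendsto_invPassiveProb.sub_const 1).const_mul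
    (1 / B.srv - B.thresholdCost W m)).div_const B.arr).const_add (1 / (B.arr * B.srv)))
  simp only [sub_self, mul_zero, zero_div, add_zero] at this
  exact this

lemma tendsto_thresholdCost (W : ℝ) : Tendsto (B.thresholdCost W) atTop atTop := by
  have hnum : Tendsto (fun n : ℕ => (n : ℝ) / B.arr - W) atTop atTop :=
    tendsto_atTop_add_const_right _ _ (tendsto_natCast_atTop_atTop.atTop_div_const B.arr_pos)
  have hfrac : Tendsto (fun n : ℕ => B.passiveFraction (n + 1)) atTop (nhds 1) := by
    simpa [passiveFraction] using B.tendsto_invPassiveProb.inv₀ one_ne_zero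
  rw [← tendsto_add_atTop_iff_nat 1]
  simp only [thresholdCost, Nat.cast_add, Nat.cast_one, add_sub_cancel_right]
  exact tendsto_atTop_add_const_left _ _ (hnum.atTop_mul_pos one_pos hfrac)

lemma exists_minimal_thresholdCost (W : ℝ) :
    ∃ m, ∀ k, B.thresholdCost W m ≤ B.thresholdCost W k := by
  refine Filter.Tendsto.exists_forall_le (f := B.thresholdCost W) ?_
  rw [Nat.cofinite_eq_atTop]
  exact B.tendsto_thresholdCost W

lemma exists_forall_sum_range_le {d : ℕ → ℝ} {N : ℕ} (hd : ∀ s, N ≤ s → d s ≤ 0) :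
    ∃ M, ∀ s, ∑ k ∈ Finset.range s, d k ≤ M := by
  refine ⟨∑ k ∈ Finset.range N, |d k|, fun s => ?_⟩
  rcases le_total s N with h | h
  · exact (Finset.sum_le_sum fun k _ => le_abs_self (d k)).trans
      (Finset.sum_le_sum_of_subset_of_nonneg (by simpa using h) fun k _ _ => abs_nonneg (d k))
  · induction s, h using Nat.le_induction with
    | base => exact Finset.sum_le_sum fun k _ => le_abs_self (d k)
    | succ s hs ih =>
      rw [Finset.sum_range_succ]
      linarith [hd s hs]

/-- The generator depends on a potential only through its increments `d`. -/
lemma generator_sum (c : ℝ) (d : ℕ → ℝ) (s : ℕ) (a : Bool) :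
    B.generator (fun s => c + ∑ k ∈ Finset.range s, d k) s a
      = B.arr * d s - B.deathRate s a * d (s - 1) := by
  simp only [generator, Finset.sum_range_succ, birthRate]
  rcases s with _ | s
  · simp [deathRate]
  · rw [Nat.add_sub_cancel, Finset.sum_range_succ]
    ring

/-- The policy that is passive exactly in the states below `m`. -/
def thresholdPolicy (m : ℕ) : ℕ → Bool := fun s => decide (m ≤ s)

lemma avgCost_thresholdPolicy_le (W : ℝ) (m s₀ : ℕ) :
    B.avgCost W (Policy.stationary (thresholdPolicy m)) s₀ ≤ B.thresholdCost W m := by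
  have hA := B.arr_pos.ne'
  -- Below the recurrent states, the increments are free to satisfy Poisson's equation.
  set d : ℕ → ℝ := fun s =>
    if s + 1 < m then (B.thresholdCost W m + W - s / B.arr) / B.arr else B.thresholdSlope W m s
    with hd
  have hpos : 0 < 1 / (B.arr * B.srv) := one_div_pos.2 (mul_pos B.arr_pos B.srv_pos)
  obtain ⟨N, hN⟩ := eventually_atTop.1
    (((B.tendsto_thresholdSlope W m).eventually_const_lt hpos).and (eventually_ge_atTop m))
  obtain ⟨M, hM⟩ := exists_forall_sum_range_le (d := fun s => -d s) (N := N) (by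
    intro s hs
    obtain ⟨h1, h2⟩ := hN s hs
    simp only [hd, if_neg (by omega : ¬ s + 1 < m)]
    linarith)
  refine avgCost_le (h := fun s => M + ∑ k ∈ Finset.range s, d k) s₀ (fun s => ?_) fun n x => ?_
  · have := hM s
    rw [Finset.sum_neg_distrib] at this
    linarith
  · rw [generator_sum]
    change B.netCost W x.current (thresholdPolicy m x.current) + (_ - B.deathRate x.current
      (thresholdPolicy m x.current) * _) ≤ _
    generalize x.current = s
    by_cases hs : m ≤ s
    · have h1 : thresholdPolicy m s = true := by simpa [thresholdPolicy] using hs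
      have h2 : d s = B.thresholdSlope W m s := if_neg (by omega)
      have h3 : B.srv * s * d (s - 1) = B.srv * s * B.thresholdSlope W m (s - 1) := by
        rcases s with _ | s
        · simp
        · rw [Nat.add_sub_cancel]
          congr 1
          exact if_neg (by omega)
      have h4 := B.thresholdSlope_active W (m := m) (s := s) (by omega)
      simp only [h1, netCost, cost, deathRate, if_true, h2, h3]
      linarith
    · have h1 : thresholdPolicy m s = false := by simpa [thresholdPolicy] using hs
      have h2 : B.arr * d s = B.thresholdCost W m + W - s / B.arr := by
        by_cases hs' : s + 1 < m
        · simp only [hd, if_pos hs']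
          field_simp
        · obtain rfl : m = s + 1 := by omega
          simp only [hd, if_neg hs']
          rw [thresholdSlope_passive]
          ring
      simp only [h1, netCost, cost, deathRate, h2]
      simp

/-- Lower bound from increments `d` of a potential that satisfy the drift inequality along the
policy and are nonpositive in arbitrarily large states: past such a state they can be replaced by
`0`, since the holding cost alone exceeds `g` there, and the resulting potential is bounded. -/
lemma le_avgCost_of_slope {W g : ℝ} {π : Policy} (s₀ : ℕ) {d : ℕ → ℝ}
    (hd : ∀ N, ∃ s, N ≤ s ∧ d s ≤ 0)
    (hdrift : ∀ n (x : History n), g ≤ B.netCost W x.current (π.act n x)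
      + (B.arr * d x.current - B.deathRate x.current (π.act n x) * d (x.current - 1))) :
    (g : EReal) ≤ B.avgCost W π s₀ := by
  obtain ⟨N, hN⟩ := exists_nat_ge (B.arr * (|g| + |W|))
  obtain ⟨r, hr, hdr⟩ := hd N
  set e : ℕ → ℝ := fun s => if s ≤ r then d s else 0 with he
  obtain ⟨M, hM⟩ := exists_forall_sum_range_le (d := e) (N := r + 1) (by
    intro s hs
    simp only [he, if_neg (by omega : ¬ s ≤ r), le_refl])
  refine le_avgCost (h := fun s => 0 + ∑ k ∈ Finset.range s, e k) (M := M) s₀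
    (fun s => by simpa using hM s) fun n x => ?_
  have hx := hdrift n x
  rw [generator_sum]
  revert hx
  generalize x.current = s
  generalize π.act n x = a
  intro hx
  by_cases hs : s ≤ r
  · have h1 : e s = d s := if_pos hs
    have h2 : e (s - 1) = d (s - 1) := if_pos (by omega)
    rwa [h1, h2]
  · have h1 : e s = 0 := if_neg hs
    have h2 : e (s - 1) ≤ 0 := by
      by_cases h : s - 1 ≤ r
      · obtain rfl : r = s - 1 := by omega
        simpa [he] using hdr
      · simp [he, h]
    have h3 := mul_nonpos_of_nonneg_of_nonpos (B.deathRate_nonneg s a) h2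
    have h4 : |g| + |W| ≤ s / B.arr := by
      rw [le_div_iff₀' B.arr_pos]
      exact hN.trans (by exact_mod_cast hr.trans (not_le.1 hs).le)
    have h5 : W * (if a then 0 else 1) ≤ |W| := by
      split_ifs
      · simp
      · simpa using le_abs_self W
    simp only [netCost, cost, h1]
    linarith [le_abs_self g]

/-- `m` is the threshold of the stationary policy `φ`: all states from `m` on are active, and
`m - 1` (if `m` is not `0`) is passive. The states below `m - 1` are transient, and `φ` is arbitrary
there. -/
def IsThreshold (φ : ℕ → Bool) (m : ℕ) : Prop :=
  (∀ s, m ≤ s → φ s = true) ∧ ∀ n, m = n + 1 → φ n = false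

lemma IsThreshold.unique {φ : ℕ → Bool} {m k : ℕ} (hm : IsThreshold φ m) (hk : IsThreshold φ k) :
    m = k := by
  by_contra hne
  wlog hlt : m < k generalizing m k
  · exact this hk hm (Ne.symm hne) (by omega)
  obtain ⟨n, rfl⟩ : ∃ n, k = n + 1 := ⟨k - 1, by omega⟩
  simpa [hm.1 n (by omega)] using hk.2 n rfl

/-- Solving Poisson's equation upwards along a stationary policy `φ` with a constant `g` below the
cost of its threshold gives increments that fall behind those of the true solution by an amount
growing linearly, at least; if `φ` has no threshold, they are nonpositive at large passive
states, where the recursion forgets the past. -/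
lemma exists_slope_nonpos {W g : ℝ} {φ : ℕ → Bool}
    (hg : ∀ m, IsThreshold φ m → g < B.thresholdCost W m)
    {d : ℕ → ℝ} (hd : ∀ s : ℕ, B.arr * d s
      = g - s / B.arr + if φ s then B.srv * s * d (s - 1) else W) (N : ℕ) :
    ∃ s, N ≤ s ∧ d s ≤ 0 := by
  have hA := B.arr_pos
  have hS := B.srv_pos
  by_cases hex : ∃ m, ∀ s, m ≤ s → φ s = true
  · classical
    have hthr : IsThreshold φ (Nat.find hex) := by
      refine ⟨Nat.find_spec hex, fun n hn => ?_⟩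
      have hmin := Nat.find_min hex (m := n) (by omega)
      by_contra hφ
      refine hmin fun s hs => ?_
      rcases hs.eq_or_lt with rfl | hs
      · simpa using hφ
      · exact Nat.find_spec hex s (by omega)
    obtain ⟨m, hm⟩ : ∃ m, IsThreshold φ m := ⟨_, hthr⟩
    have hgm := hg m hm
    set c := B.thresholdCost W m - g with hc
    have hcpos : 0 < c := sub_pos.2 hgm
    have hstep : ∀ s, m ≤ s → (s ≠ 0 ∨ m = 0) → B.arr * (d s - B.thresholdSlope W m s)
        = -c + B.srv * s * (d (s - 1) - B.thresholdSlope W m (s - 1)) := by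
      intro s hs h0
      have h1 := hd s
      rw [if_pos (hm.1 s hs)] at h1
      linear_combination h1 - B.thresholdSlope_active W h0
    have hgap : ∀ s, m ≤ s + 1 → B.arr * (d s - B.thresholdSlope W m s) ≤ -c := by
      intro s hs
      induction s with
      | zero =>
        rcases Nat.eq_zero_or_pos m with rfl | hpos
        · rw [hstep 0 le_rfl (Or.inr rfl)]
          simp
        · obtain rfl : m = 0 + 1 := by omega
          have h1 := hd 0
          rw [hm.2 0 rfl, if_neg (by simp)] at h1
          linarith [B.thresholdSlope_passive W 0]
      | succ s ih =>
        rcases Nat.lt_or_ge (s + 1) m with hlt | hge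
        · obtain rfl : m = s + 1 + 1 := by omega
          have h1 := hd (s + 1)
          rw [hm.2 (s + 1) rfl, if_neg (by simp)] at h1
          linarith [B.thresholdSlope_passive W (s + 1)]
        · rw [hstep (s + 1) hge (Or.inl (by omega)), Nat.add_sub_cancel]
          have h1 : d s - B.thresholdSlope W m s ≤ 0 := by
            by_contra hneg
            nlinarith [ih hge, mul_pos hA (not_le.1 hneg)]
          have h2 := mul_nonpos_of_nonneg_of_nonpos
            (mul_nonneg hS.le (Nat.cast_nonneg (α := ℝ) (s + 1))) h1
          linarith
    have hlim : Tendsto (fun s : ℕ => B.srv * (s : ℝ) * (c / B.arr)) atTop atTop :=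
      (tendsto_natCast_atTop_atTop.const_mul_atTop hS).atTop_mul_const (div_pos hcpos hA)
    have hslope := (B.tendsto_thresholdSlope W m).eventually_lt_const
      (lt_add_one (1 / (B.arr * B.srv)))
    obtain ⟨s, ⟨h1, h2⟩, h3⟩ := ((hslope.and (hlim.eventually_ge_atTop
      (B.arr * (1 / (B.arr * B.srv) + 1)))).and (eventually_ge_atTop (N + m + 1))).exists
    refine ⟨s, by omega, ?_⟩
    have h4 := hstep s (by omega) (Or.inl (by omega))
    have h5 := hgap (s - 1) (by omega)
    have h6 : d (s - 1) - B.thresholdSlope W m (s - 1) ≤ -(c / B.arr) := by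
      rw [← neg_div, le_div_iff₀' hA]
      exact h5
    have h7 := mul_le_mul_of_nonneg_left h6 (mul_nonneg hS.le (Nat.cast_nonneg (α := ℝ) s))
    have h8 := mul_lt_mul_of_pos_left h1 hA
    by_contra hneg
    linarith [mul_pos hA (not_le.1 hneg)]
  · push Not at hex
    obtain ⟨k, hk⟩ := exists_nat_ge (B.arr * (|g| + |W|))
    obtain ⟨s, hs, hφ⟩ := hex (N + k)
    refine ⟨s, by omega, ?_⟩
    have h1 := hd s
    rw [if_neg (by simpa using hφ)] at h1
    have h4 : |g| + |W| ≤ s / B.arr := by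
      rw [le_div_iff₀' hA]
      exact hk.trans (by exact_mod_cast (by omega : k ≤ s))
    by_contra hneg
    linarith [mul_pos hA (not_le.1 hneg), le_abs_self g, le_abs_self W]

/-- Existence of a sequence defined by a recursion whose value at `0` needs no predecessor. -/
lemma exists_recursion (f : ℕ → ℝ → ℝ) (hf : ∀ y z, f 0 y = f 0 z) :
    ∃ d : ℕ → ℝ, ∀ s, d s = f s (d (s - 1)) := by
  refine ⟨fun s => Nat.rec (f 0 0) (fun n y => f (n + 1) y) s, fun s => ?_⟩
  cases s with
  | zero => exact hf _ _
  | succ n => rfl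

lemma le_avgCost_stationary {W g : ℝ} {φ : ℕ → Bool}
    (hg : ∀ m, IsThreshold φ m → g < B.thresholdCost W m) (s₀ : ℕ) :
    (g : EReal) ≤ B.avgCost W (Policy.stationary φ) s₀ := by
  have hA := B.arr_pos.ne'
  obtain ⟨d, hd⟩ := exists_recursion
    (fun s y => (g - s / B.arr + if φ s then B.srv * s * y else W) / B.arr) (fun y z => by simp)
  have hd' : ∀ s : ℕ, B.arr * d s
      = g - s / B.arr + if φ s then B.srv * s * d (s - 1) else W := by
    intro s
    rw [hd s]
    field_simp
  refine B.le_avgCost_of_slope s₀ (B.exists_slope_nonpos hg hd') fun n x => ?_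
  change g ≤ B.netCost W x.current (φ x.current)
    + (_ - B.deathRate x.current (φ x.current) * _)
  generalize x.current = s
  rw [hd' s]
  cases h : φ s <;> simp [netCost, cost, deathRate]

/-- Lower bound for all history-dependent policies: the increments solve the optimality equation
upwards, and therefore also Poisson's equation for the stationary policy that attains the
maximum. -/
lemma le_avgCost_of_lt_thresholdCost {W g : ℝ} (hg : ∀ m, g < B.thresholdCost W m) (π : Policy)
    (s₀ : ℕ) : (g : EReal) ≤ B.avgCost W π s₀ := by
  have hA := B.arr_pos.ne'
  obtain ⟨d, hd⟩ := exists_recursion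
    (fun s y => (g - s / B.arr + max W (B.srv * s * y)) / B.arr) (fun y z => by simp)
  have hd' : ∀ s : ℕ, B.arr * d s = g - s / B.arr + max W (B.srv * s * d (s - 1)) := by
    intro s
    rw [hd s]
    field_simp
  refine B.le_avgCost_of_slope s₀ (d := d) (B.exists_slope_nonpos
    (φ := fun s => decide (W ≤ B.srv * s * d (s - 1))) (fun m _ => hg m) fun s => ?_) fun n x => ?_
  · rw [hd' s, max_def]
    simp
  · generalize x.current = s
    have h1 := le_max_left W (B.srv * s * d (s - 1))
    have h2 := le_max_right W (B.srv * s * d (s - 1))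
    rw [hd' s]
    cases π.act n x <;> simp [netCost, cost, deathRate] <;> linarith

lemma isOptimal_thresholdPolicy {W : ℝ} {m : ℕ}
    (hm : ∀ k, B.thresholdCost W m ≤ B.thresholdCost W k) : B.IsOptimal W (thresholdPolicy m) := by
  intro s₀ π
  refine (B.avgCost_thresholdPolicy_le W m s₀).trans ?_
  refine EReal.ge_of_forall_gt_iff_ge.1 fun g hg => ?_
  exact B.le_avgCost_of_lt_thresholdCost
    (fun k => (EReal.coe_lt_coe_iff.1 hg).trans_le (hm k)) π s₀

/-- Optimal stationary policies have a threshold, and it minimizes the cost among thresholds. -/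
lemma IsOptimal.exists_isThreshold {W : ℝ} {φ : ℕ → Bool} (hφ : B.IsOptimal W φ) :
    ∃ m, IsThreshold φ m ∧ ∀ k, B.thresholdCost W m ≤ B.thresholdCost W k := by
  have hle : ∀ k, B.avgCost W (Policy.stationary φ) 0 ≤ B.thresholdCost W k := fun k =>
    (hφ 0 _).trans (B.avgCost_thresholdPolicy_le W k 0)
  by_cases hex : ∃ m, IsThreshold φ m
  · obtain ⟨m, hm⟩ := hex
    refine ⟨m, hm, fun k => EReal.coe_le_coe_iff.1 (le_trans ?_ (hle k))⟩
    refine EReal.ge_of_forall_gt_iff_ge.1 fun g hg => B.le_avgCost_stationary (fun j hj => ?_) 0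
    rw [hj.unique hm]
    exact EReal.coe_lt_coe_iff.1 hg
  · have h1 := B.le_avgCost_stationary (W := W) (g := B.thresholdCost W 0 + 1)
      (fun j hj => absurd ⟨j, hj⟩ hex) 0
    have h2 := EReal.coe_le_coe_iff.1 (h1.trans (hle 0))
    linarith

/-- Minimizing thresholds increase with the subsidy, because the fraction of passive time increases
with the threshold. -/
lemma threshold_le_of_lt {W W' : ℝ} (hW : W' < W) {m k : ℕ}
    (hm : ∀ j, B.thresholdCost W' m ≤ B.thresholdCost W' j)
    (hk : ∀ j, B.thresholdCost W k ≤ B.thresholdCost W j) : m ≤ k := by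
  by_contra hlt
  have h1 := B.strictMono_passiveFraction (not_le.1 hlt)
  have h2 := hm k
  have h3 := hk m
  simp only [thresholdCost] at h2 h3
  nlinarith

lemma indexable : B.Indexable := by
  rintro W W' hW s ⟨φ, hφ, hs⟩
  obtain ⟨m, hthr, hm⟩ := IsOptimal.exists_isThreshold B hφ
  obtain ⟨k, hk⟩ := B.exists_minimal_thresholdCost W
  have hmk := B.threshold_le_of_lt hW hm hk
  have hsm : s < m := by
    by_contra h
    simp [hthr.1 s (not_lt.1 h)] at hs
  refine ⟨thresholdPolicy k, B.isOptimal_thresholdPolicy hk, ?_⟩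
  simp only [thresholdPolicy, decide_eq_false_iff_not]
  omega

end Service

end EdgeService

end

/-- For every service and every subsidy `W` the single-service problem has an optimal stationary
policy (so that the sets `D_i(W)` are meaningful), and the service-placement problem is
indexable. -/
theorem mainTheorem3 {N K : ℕ} (M : EdgeService.ServicePlacement N K) :
    (∀ (i : Fin N) (W : ℝ), ∃ φ : ℕ → Bool, (M.service i).IsOptimal W φ) ∧ M.Indexable := by
  refine ⟨fun i W => ?_, fun i => (M.service i).indexable⟩
  obtain ⟨m, hm⟩ := (M.service i).exists_minimal_thresholdCost W
  exact ⟨_, (M.service i).isOptimal_thresholdPolicy hm⟩
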